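/- Let $\nu$ be a finite Borel measure supported on the unit circle $\{|z|=1\}$. For $a\in\mathbb C$, $r>0$ let $\mathbb D(a;r)=\{z:|z-a|<r\}$, $\mathbb D=\mathbb D(0;1)$, let $\mathbf m_{a;r}$ be the normalized Lebesgue (arc length) measure on the circle $\{|z-a|=r\}$, and $\mathbf m=\mathbf m_{0;1}$. Write the Lebesgue decomposition $\nu=h\,d\mathbf m+\nu_s$ with $\nu_s$ singular with respect to $\mathbf m$, and suppose that $\nu$ satisfies the Szegő condition $\log h\in L^1(\mathbf m)$ (in particular $h>0$ $\mathbf m$-almost everywhere). Consider on the space $\mathbb P[z]$ of complex polynomials the inner product $\langle\cdot,\cdot\rangle_{\mathbf S}$ whose norm is given by either of the following: 1. $\displaystyle\|p\|_{\mathbf S}^2=\int|p|^2\,d\nu+\sum_{k=1}^n|p'(a_k)|^2$, where $a_1,\dots,a_n\in\mathbb D$; 2. $\displaystyle\|p\|_{\mathbf S}^2=\int|p|^2\,d\nu+\sum_{k=1}^n\int|p'|^2\,d\mathbf m_{a_k;r_k}$, where $a_1,\dots,a_n\in\mathbb C$, $r_1,\dots,r_n>0$ and $\mathbb D(a_k;r_k)\subset\mathbb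 D$ for every $k$. In both cases the multiplication operator $\mathcal D:\mathbb P[z]\to\mathbb P[z]$, $(\mathcal Dp)(z)=zp(z)$, is bounded on $(\mathbb P[z],\|\cdot\|_{\mathbf S})$, that is, there is a constant $C$ with $\|zp\|_{\mathbf S}\le C\|p\|_{\mathbf S}$ for all $p\in\mathbb P[z]$. Moreover, the set of all zeros of all Sobolev orthogonal polynomials (the nonzero polynomials $P$ with $\langle P,q\rangle_{\mathbf S}=0$ for every polynomial $q$ of degree less than $\deg P$) is bounded. -/

import Mathlib

open MeasureTheory Polynomial
open scoped ComplexConjugate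

/-- The normalized Lebesgue (arc length) measure on the circle `|z - a| = r`, as a measure on `ℂ`:
the image of the uniform probability measure on `(0, 2π]` under `θ ↦ a + r e^{iθ}`. -/
noncomputable def circleLebesgue (a : ℂ) (r : ℝ) : Measure ℂ :=
  Measure.map (circleMap a r)
    (ENNReal.ofReal (2 * Real.pi)⁻¹ • volume.restrict (Set.Ioc 0 (2 * Real.pi)))

/-- The Szegő condition `log h ∈ L¹(m)`, where `m` is the normalized Lebesgue measure on the unit
circle and `h` is the density of the absolutely continuous part of `ν` with respect to `m`.
Since `Real.log 0 = 0`, the requirement `log h > -∞` almost everywhere is a separate clause. -/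
def SzegoCondition (ν : Measure ℂ) : Prop :=
  (∀ᵐ z ∂(circleLebesgue 0 1), 0 < ν.rnDeriv (circleLebesgue 0 1) z) ∧
    Integrable (fun z => Real.log (ν.rnDeriv (circleLebesgue 0 1) z).toReal) (circleLebesgue 0 1)

/-- `⟨p, q⟩ = ∫ p q̄ dν + ∑ p'(a_k) q̄'(a_k)`. -/
noncomputable def discreteSobolevInner (ν : Measure ℂ) {n : ℕ} (a : Fin n → ℂ) (p q : ℂ[X]) : ℂ :=
  (∫ z, p.eval z * conj (q.eval z) ∂ν) +
    ∑ k, p.derivative.eval (a k) * conj (q.derivative.eval (a k))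

/-- `‖p‖ = (∫ |p|² dν + ∑ |p'(a_k)|²)^{1/2}`. -/
noncomputable def discreteSobolevNorm (ν : Measure ℂ) {n : ℕ} (a : Fin n → ℂ) (p : ℂ[X]) : ℝ :=
  Real.sqrt ((∫ z, ‖p.eval z‖ ^ 2 ∂ν) + ∑ k, ‖p.derivative.eval (a k)‖ ^ 2)

/-- `⟨p, q⟩ = ∫ p q̄ dν + ∑ ∫ p' q̄' dm_{a_k; r_k}`. -/
noncomputable def circleSobolevInner (ν : Measure ℂ) {n : ℕ} (a : Fin n → ℂ) (r : Fin n → ℝ)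
    (p q : ℂ[X]) : ℂ :=
  (∫ z, p.eval z * conj (q.eval z) ∂ν) +
    ∑ k, ∫ z, p.derivative.eval z * conj (q.derivative.eval z) ∂(circleLebesgue (a k) (r k))

/-- `‖p‖ = (∫ |p|² dν + ∑ ∫ |p'|² dm_{a_k; r_k})^{1/2}`. -/
noncomputable def circleSobolevNorm (ν : Measure ℂ) {n : ℕ} (a : Fin n → ℂ) (r : Fin n → ℝ)
    (p : ℂ[X]) : ℝ :=
  Real.sqrt ((∫ z, ‖p.eval z‖ ^ 2 ∂ν) +
    ∑ k, ∫ z, ‖p.derivative.eval z‖ ^ 2 ∂(circleLebesgue (a k) (r k)))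

/-- The norms are the ones induced by the inner products. -/
theorem discreteSobolevInner_self (ν : Measure ℂ) {n : ℕ} (a : Fin n → ℂ) (p : ℂ[X]) :
    discreteSobolevInner ν a p p = ((discreteSobolevNorm ν a p ^ 2 : ℝ) : ℂ) := by
  unfold discreteSobolevInner discreteSobolevNorm
  rw [Real.sq_sqrt (by positivity)]
  have h : ∀ w : ℂ, w * conj w = ((‖w‖ ^ 2 : ℝ) : ℂ) := fun w => by
    rw [Complex.mul_conj, Complex.normSq_eq_norm_sq]
  simp only [h, integral_complex_ofReal, Complex.ofReal_add, Complex.ofReal_sum]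

theorem circleSobolevInner_self (ν : Measure ℂ) {n : ℕ} (a : Fin n → ℂ) (r : Fin n → ℝ)
    (p : ℂ[X]) :
    circleSobolevInner ν a r p p = ((circleSobolevNorm ν a r p ^ 2 : ℝ) : ℂ) := by
  unfold circleSobolevInner circleSobolevNorm
  rw [Real.sq_sqrt (by positivity)]
  have h : ∀ w : ℂ, w * conj w = ((‖w‖ ^ 2 : ℝ) : ℂ) := fun w => by
    rw [Complex.mul_conj, Complex.normSq_eq_norm_sq]
  simp only [h, integral_complex_ofReal, Complex.ofReal_add, Complex.ofReal_sum]

/-- The multiplication operator `p(z) ↦ z p(z)` is bounded on `ℂ[z]` with the norm `N`. -/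
def MultiplicationBounded (N : ℂ[X] → ℝ) : Prop :=
  ∃ C : ℝ, ∀ p : ℂ[X], N (X * p) ≤ C * N p

/-- `P` is an orthogonal polynomial (of degree `deg P`, in any normalization) for the inner
product `B`: it is nonzero and orthogonal to every polynomial of smaller degree. -/
def IsOrthogonalPolynomial (B : ℂ[X] → ℂ[X] → ℂ) (P : ℂ[X]) : Prop :=
  P ≠ 0 ∧ ∀ q : ℂ[X], q.degree < P.degree → B P q = 0

/-- The set of all zeros of all orthogonal polynomials for `B`. -/
def orthogonalZeros (B : ℂ[X] → ℂ[X] → ℂ) : Set ℂ :=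
  {z | ∃ P : ℂ[X], IsOrthogonalPolynomial B P ∧ P.IsRoot z}

/-! ### The normalized Lebesgue measure on a circle -/

/-! Both norms have the form `‖p‖² = ∫ |p|² dν + ∑ ∫ |p'|² dμ_k` with finite `μ_k` on the closed
disc. As `(zp)' = p + zp'`, boundedness of multiplication reduces to `∫ |p|² dμ_k ≤ C ‖p‖²`. This
comes from bounded point evaluation in the open disc. With `P_a` the Poisson kernel, subharmonicity
of `log |p|` and Jensen give `log |p(a)|² + ∫ P_a log h dm ≤ log ∫ P_a h |p|² dm`; the Szegő
condition makes the left integral finite, and `P_a` is bounded. That settles Dirac masses; on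
circles a Poincaré inequality reduces `∫ |p|²` to the centre value and `∫ |p'|²`. For the zeros, let
`P = (z - w)q` be orthogonal. Then `P ⊥ q` and `zq = P + wq`, so Pythagoras gives `|w|² ‖q‖² ≤ ‖zq‖²
≤ D ‖q‖²`. -/

instance circleLebesgue.isProbabilityMeasure (c : ℂ) (R : ℝ) :
    IsProbabilityMeasure (circleLebesgue c R) := by
  refine ⟨?_⟩
  rw [circleLebesgue, Measure.map_apply (continuous_circleMap c R).measurable MeasurableSet.univ]
  have h : (0 : ℝ) < 2 * Real.pi := Real.two_pi_pos
  simp only [Set.preimage_univ, Measure.smul_apply, Measure.restrict_apply_univ, Real.volume_Ioc,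
    sub_zero, smul_eq_mul]
  rw [← ENNReal.ofReal_mul (by positivity), inv_mul_cancel₀ h.ne', ENNReal.ofReal_one]

theorem circleLebesgue_apply_singleton (c : ℂ) {R : ℝ} (hR : R ≠ 0) (z : ℂ) :
    circleLebesgue c R {z} = 0 := by
  rw [circleLebesgue, Measure.map_apply (continuous_circleMap c R).measurable
    (measurableSet_singleton z), Measure.smul_apply, Measure.restrict_apply
    ((continuous_circleMap c R).measurable (measurableSet_singleton z))]
  have hs : (circleMap c R ⁻¹' {z} ∩ Set.Ioc 0 (2 * Real.pi)).Subsingleton := by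
    intro x hx y hy
    have hinj : Set.InjOn (circleMap c R) (Set.Ioc 0 (2 * Real.pi)) := by
      have h := injOn_circleMap_of_abs_sub_le (a := 0) (b := 2 * Real.pi) (c := c) hR
        (by simp [abs_of_pos Real.pi_pos])
      rwa [Set.uIoc_of_le Real.two_pi_pos.le] at h
    exact hinj hx.2 hy.2 (hx.1.trans hy.1.symm)
  rw [hs.measure_zero, smul_zero]

theorem ae_circleLebesgue_mem_sphere (c : ℂ) {R : ℝ} (hR : 0 ≤ R) :
    ∀ᵐ z ∂(circleLebesgue c R), z ∈ Metric.sphere c R := by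
  refine (ae_map_iff (p := fun z => z ∈ Metric.sphere c R)
    (continuous_circleMap c R).aemeasurable Metric.isClosed_sphere.measurableSet).2 ?_
  exact Filter.Eventually.of_forall fun θ => circleMap_mem_sphere c hR θ

theorem ae_circleLebesgue_eval_ne_zero (c : ℂ) {R : ℝ} (hR : R ≠ 0) {p : ℂ[X]} (hp : p ≠ 0) :
    ∀ᵐ z ∂(circleLebesgue c R), p.eval z ≠ 0 := by
  have : NullSingletonClass (circleLebesgue c R) := ⟨circleLebesgue_apply_singleton c hR⟩
  have h : circleLebesgue c R (p.roots.toFinset : Set ℂ) = 0 :=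
    (Finset.finite_toSet _).measure_zero _
  filter_upwards [measure_eq_zero_iff_ae_notMem.1 h] with z hz h0
  exact hz (by simp [hp, h0])

theorem integrable_circleLebesgue {f : ℂ → ℝ} {c : ℂ} {R : ℝ} (hm : Measurable f)
    (hf : CircleIntegrable f c R) : Integrable f (circleLebesgue c R) := by
  rw [circleLebesgue, integrable_map_measure hm.aestronglyMeasurable
    (continuous_circleMap c R).aemeasurable]
  refine Integrable.smul_measure ?_ ENNReal.ofReal_ne_top
  have h := intervalIntegrable_iff.1 hf
  rwa [Set.uIoc_of_le Real.two_pi_pos.le] at h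

theorem integral_circleLebesgue {f : ℂ → ℝ} (hm : Measurable f) (c : ℂ) (R : ℝ) :
    ∫ z, f z ∂(circleLebesgue c R) = Real.circleAverage f c R := by
  rw [circleLebesgue, integral_map (continuous_circleMap c R).aemeasurable
    hm.aestronglyMeasurable, integral_smul_measure, Real.circleAverage,
    intervalIntegral.integral_of_le Real.two_pi_pos.le,
    ENNReal.toReal_ofReal (inv_nonneg.2 Real.two_pi_pos.le)]

/-! ### The Poisson kernel and subharmonicity of `log |p|` -/

/-- The Poisson kernel of the unit disc at `a`. -/
noncomputable def discKernel (a z : ℂ) : ℝ := (herglotzRieszKernel 0 a z).re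

theorem measurable_discKernel (a : ℂ) : Measurable (discKernel a) := by
  unfold discKernel herglotzRieszKernel
  fun_prop

theorem continuousOn_discKernel {a : ℂ} (ha : a ∈ Metric.ball (0 : ℂ) 1) :
    ContinuousOn (discKernel a) (Metric.sphere (0 : ℂ) |1|) :=
  Complex.continuous_re.comp_continuousOn (continuousOn_herglotzRieszKernel_sphere ha)

theorem discKernel_nonneg {a z : ℂ} (ha : a ∈ Metric.ball (0 : ℂ) 1)
    (hz : z ∈ Metric.sphere (0 : ℂ) 1) : 0 ≤ discKernel a z := by
  refine le_trans ?_ (le_re_herglotzRieszKernel hz ha)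
  have : ‖a‖ < 1 := by simpa using ha
  rw [sub_zero]
  exact div_nonneg (by linarith) (by positivity)

theorem discKernel_le {a z : ℂ} (ha : a ∈ Metric.ball (0 : ℂ) 1)
    (hz : z ∈ Metric.sphere (0 : ℂ) 1) : discKernel a z ≤ (1 + ‖a‖) / (1 - ‖a‖) := by
  have h := re_herglotzRieszKernel_le hz ha
  simpa only [discKernel, herglotzRieszKernel_def, sub_zero] using h

theorem circleIntegrable_discKernel_mul {a : ℂ} (ha : a ∈ Metric.ball (0 : ℂ) 1) {f : ℂ → ℝ}
    (hf : CircleIntegrable f 0 1) : CircleIntegrable (fun z => discKernel a z * f z) 0 1 :=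
  hf.continuousOn_smul (continuousOn_discKernel ha)

theorem circleAverage_discKernel_mul_of_harmonic {a : ℂ} (ha : a ∈ Metric.ball (0 : ℂ) 1)
    {f : ℂ → ℝ} (hf : InnerProductSpace.HarmonicOnNhd f (Metric.closedBall 0 1)) :
    Real.circleAverage (fun z => discKernel a z * f z) 0 1 = f a :=
  hf.circleAverage_re_herglotzRieszKernel_smul ha

theorem circleAverage_discKernel {a : ℂ} (ha : a ∈ Metric.ball (0 : ℂ) 1) :
    Real.circleAverage (discKernel a) 0 1 = 1 := by
  have h := circleAverage_discKernel_mul_of_harmonic ha (f := fun _ => 1)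
    (fun z _ => InnerProductSpace.harmonicAt_const 1)
  simpa using h

theorem norm_one_sub_conj_mul_eq {w z : ℂ} (hz : ‖z‖ = 1) : ‖1 - conj w * z‖ = ‖z - w‖ := by
  have h : z * conj z = 1 := by rw [Complex.mul_conj, Complex.normSq_eq_norm_sq, hz]; simp
  calc ‖1 - conj w * z‖ = ‖z * conj (z - w)‖ := by
        rw [map_sub, mul_sub, h, mul_comm z (conj w)]
    _ = ‖z - w‖ := by rw [norm_mul, hz, one_mul, Complex.norm_conj]

theorem norm_sub_le_norm_one_sub_conj_mul {w z : ℂ} (hw : ‖w‖ ≤ 1) (hz : ‖z‖ ≤ 1) :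
    ‖z - w‖ ≤ ‖1 - conj w * z‖ := by
  refine le_of_sq_le_sq ?_ (norm_nonneg _)
  have h : ‖1 - conj w * z‖ ^ 2 - ‖z - w‖ ^ 2 = (1 - ‖w‖ ^ 2) * (1 - ‖z‖ ^ 2) := by
    simp only [← Complex.normSq_eq_norm_sq, Complex.normSq_apply, Complex.sub_re, Complex.sub_im,
      Complex.mul_re, Complex.mul_im, Complex.conj_re, Complex.conj_im, Complex.one_re,
      Complex.one_im]
    ring
  have := mul_nonneg (sub_nonneg.2 (pow_le_one₀ (n := 2) (norm_nonneg w) hw))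
    (sub_nonneg.2 (pow_le_one₀ (n := 2) (norm_nonneg z) hz))
  linarith

/-- For `|w| ≥ 1` Poisson's formula holds with equality. For `|w| < 1`, replace `z - w` by `1 -
w̄z`: same modulus on the circle, no zero in the closed disc, and larger modulus at `a`. -/
theorem log_norm_sub_le_circleAverage {a w : ℂ} (ha : a ∈ Metric.ball (0 : ℂ) 1) (haw : a ≠ w) :
    Real.log ‖a - w‖ ≤
      Real.circleAverage (fun z => discKernel a z * Real.log ‖z - w‖) 0 1 := by
  have ha1 : ‖a‖ < 1 := by simpa using ha
  rcases lt_trichotomy ‖w‖ 1 with hw | hw | hw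
  · have hne : ∀ z ∈ Metric.closedBall (0 : ℂ) 1, 1 - conj w * z ≠ 0 := by
      intro z hz h
      have h1 : ‖conj w * z‖ = 1 := by rw [← sub_eq_zero.1 h, norm_one]
      rw [norm_mul, Complex.norm_conj] at h1
      have hz : ‖z‖ ≤ 1 := by simpa using hz
      nlinarith [norm_nonneg w, norm_nonneg z]
    have h := circleAverage_discKernel_mul_of_harmonic ha
      (f := fun z => Real.log ‖1 - conj w * z‖)
      (fun z hz => AnalyticAt.harmonicAt_log_norm (by fun_prop) (hne z hz))
    have hc : Set.EqOn (fun z => discKernel a z * Real.log ‖z - w‖)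
        (fun z => discKernel a z * Real.log ‖1 - conj w * z‖) (Metric.sphere 0 |1|) := by
      intro z hz
      have hz : ‖z‖ = 1 := by simpa using hz
      simp only [norm_one_sub_conj_mul_eq hz]
    rw [Real.circleAverage_congr_sphere hc, h]
    exact Real.log_le_log (norm_pos_iff.2 (sub_ne_zero.2 haw))
      (norm_sub_le_norm_one_sub_conj_mul hw.le ha1.le)
  · exact (circleAverage_re_herglotzRieszKernel_mul_log (by simpa using hw) ha).ge
  · refine (circleAverage_discKernel_mul_of_harmonic ha (f := fun z => Real.log ‖z - w‖)
      (fun z hz => AnalyticAt.harmonicAt_log_norm (by fun_prop) ?_)).ge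
    intro h
    have hz : ‖z‖ ≤ 1 := by simpa using hz
    rw [sub_eq_zero.1 h] at hz
    linarith

theorem measurable_log_norm_eval (p : ℂ[X]) : Measurable fun z => Real.log ‖p.eval z‖ :=
  Real.measurable_log.comp p.continuous.norm.measurable

theorem circleIntegrable_log_norm_eval (p : ℂ[X]) (c : ℂ) (R : ℝ) :
    CircleIntegrable (fun z => Real.log ‖p.eval z‖) c R :=
  MeromorphicOn.circleIntegrable_log_norm fun z _ =>
    ((AnalyticOnNhd.aeval_polynomial analyticOnNhd_id p) z (Set.mem_univ z)).meromorphicAt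

theorem integrable_discKernel_mul_log_norm_eval {a : ℂ} (ha : a ∈ Metric.ball (0 : ℂ) 1)
    (p : ℂ[X]) :
    Integrable (fun z => discKernel a z * Real.log ‖p.eval z‖) (circleLebesgue 0 1) :=
  integrable_circleLebesgue ((measurable_discKernel a).mul (measurable_log_norm_eval p))
    (circleIntegrable_discKernel_mul ha (circleIntegrable_log_norm_eval p 0 1))

/-- Subharmonicity of `log |p|`. -/
theorem log_norm_eval_le_integral {a : ℂ} (ha : a ∈ Metric.ball (0 : ℂ) 1) (p : ℂ[X])
    (hp : p.eval a ≠ 0) :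
    Real.log ‖p.eval a‖ ≤ ∫ z, discKernel a z * Real.log ‖p.eval z‖ ∂(circleLebesgue 0 1) := by
  induction h : p.natDegree generalizing p with
  | zero =>
    obtain ⟨c, rfl⟩ := natDegree_eq_zero.1 h
    simp only [eval_C]
    rw [integral_mul_const, integral_circleLebesgue (measurable_discKernel a),
      circleAverage_discKernel ha, one_mul]
  | succ n ih =>
    obtain ⟨w, hw⟩ := IsAlgClosed.exists_root p (by
      intro h0
      rw [natDegree_eq_zero_iff_degree_le_zero.2 h0.le] at h
      omega)
    obtain ⟨q, rfl⟩ := dvd_iff_isRoot.2 hw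
    rw [eval_mul] at hp
    have hp0 : (X - C w) * q ≠ 0 := by
      rintro h0
      rw [← eval_mul, h0, eval_zero] at hp
      exact hp rfl
    have hq : q.natDegree = n := by
      rw [natDegree_mul (X_sub_C_ne_zero w) (right_ne_zero_of_mul hp0), natDegree_X_sub_C] at h
      omega
    have hlin : Real.log ‖(X - C w).eval a‖ ≤
        ∫ z, discKernel a z * Real.log ‖(X - C w).eval z‖ ∂(circleLebesgue 0 1) := by
      refine le_of_le_of_eq ?_ (integral_circleLebesgue ((measurable_discKernel a).mul
        (measurable_log_norm_eval (X - C w))) 0 1).symm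
      change _ ≤ Real.circleAverage (fun z => discKernel a z * Real.log ‖(X - C w).eval z‖) 0 1
      have haw : a ≠ w := by
        rintro rfl
        simp at hp
      simpa using log_norm_sub_le_circleAverage ha haw
    -- Since `Real.log 0 = 0`, the logarithm of the product splits only off the zeros, a null set.
    have hae : (fun z => discKernel a z * Real.log ‖((X - C w) * q).eval z‖)
        =ᵐ[circleLebesgue 0 1] fun z => discKernel a z * Real.log ‖(X - C w).eval z‖ +
          discKernel a z * Real.log ‖q.eval z‖ := by
      filter_upwards [ae_circleLebesgue_eval_ne_zero 0 one_ne_zero hp0] with z hz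
      rw [eval_mul] at hz ⊢
      rw [norm_mul, Real.log_mul (norm_ne_zero_iff.2 (left_ne_zero_of_mul hz))
        (norm_ne_zero_iff.2 (right_ne_zero_of_mul hz)), mul_add]
    rw [integral_congr_ae hae, integral_add (integrable_discKernel_mul_log_norm_eval ha _)
      (integrable_discKernel_mul_log_norm_eval ha _), eval_mul, norm_mul,
      Real.log_mul (norm_ne_zero_iff.2 (left_ne_zero_of_mul hp))
        (norm_ne_zero_iff.2 (right_ne_zero_of_mul hp))]
    exact add_le_add hlin (ih q (right_ne_zero_of_mul hp) hq)

/-! ### Bounded point evaluations -/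

theorem integrable_of_ae_mem_closedBall {E : Type*} [NormedAddCommGroup E] {μ : Measure ℂ}
    [IsFiniteMeasure μ] {c : ℂ} {R : ℝ} (hμ : ∀ᵐ z ∂μ, z ∈ Metric.closedBall c R) {f : ℂ → E}
    (hf : Continuous f) : Integrable f μ := by
  have h := hf.continuousOn.integrableOn_compact (μ := μ) (isCompact_closedBall c R)
  rwa [IntegrableOn, Measure.restrict_eq_self_of_ae_mem hμ] at h

/-- Under the Szegő condition, evaluation at a point of the disc is bounded in `L²(ν)`. -/
theorem SzegoCondition.exists_norm_eval_sq_le {ν : Measure ℂ} [IsFiniteMeasure ν]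
    (hν : ∀ᵐ z ∂ν, z ∈ Metric.closedBall (0 : ℂ) 1) (hS : SzegoCondition ν) {a : ℂ}
    (ha : a ∈ Metric.ball (0 : ℂ) 1) :
    ∃ C : ℝ, 0 ≤ C ∧ ∀ p : ℂ[X], ‖p.eval a‖ ^ 2 ≤ C * ∫ z, ‖p.eval z‖ ^ 2 ∂ν := by
  obtain ⟨hpos, hlog⟩ := hS
  set m := circleLebesgue 0 1 with hm
  set h : ℂ → ℝ := fun z => (ν.rnDeriv m z).toReal with hh
  have ha1 : ‖a‖ < 1 := by simpa using ha
  set M : ℝ := (1 + ‖a‖) / (1 - ‖a‖) with hM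
  have hM0 : 0 ≤ M := div_nonneg (by positivity) (by linarith)
  have hsph : ∀ᵐ z ∂m, z ∈ Metric.sphere (0 : ℂ) 1 := ae_circleLebesgue_mem_sphere 0 zero_le_one
  have hKbound : ∀ᵐ z ∂m, ‖discKernel a z‖ ≤ M := by
    filter_upwards [hsph] with z hz
    rw [Real.norm_of_nonneg (discKernel_nonneg ha hz)]
    exact discKernel_le ha hz
  have hKm : AEStronglyMeasurable (discKernel a) m :=
    (measurable_discKernel a).aestronglyMeasurable
  have hKlog : Integrable (fun z => discKernel a z * Real.log (h z)) m :=
    hlog.bdd_mul hKm hKbound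
  set H := ∫ z, discKernel a z * Real.log (h z) ∂m with hH
  have hK : Integrable (discKernel a) m := by
    simpa using (integrable_const (1 : ℝ)).bdd_mul hKm hKbound
  have hK1 : ∫ z, discKernel a z ∂m = 1 := by
    rw [hm, integral_circleLebesgue (measurable_discKernel a), circleAverage_discKernel ha]
  refine ⟨M * Real.exp (-H), by positivity, fun p => ?_⟩
  by_cases hp : p.eval a = 0
  · rw [hp, norm_zero, zero_pow two_ne_zero]
    exact mul_nonneg (by positivity) (integral_nonneg fun z => by positivity)
  have hp0 : p ≠ 0 := by
    rintro rfl
    simp at hp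
  have hcont : Continuous fun z => ‖p.eval z‖ ^ 2 := p.continuous.norm.pow 2
  have hintν : Integrable (fun z => ‖p.eval z‖ ^ 2) ν := integrable_of_ae_mem_closedBall hν hcont
  -- The singular part of `ν` is dropped: it only increases the right-hand side.
  have hle := Measure.withDensity_rnDeriv_le ν m
  have htop := Measure.rnDeriv_lt_top ν m
  have hhp : Integrable (fun z => h z * ‖p.eval z‖ ^ 2) m :=
    (integrable_withDensity_iff_integrable_smul' (Measure.measurable_rnDeriv ν m) htop).1
      (hintν.mono_measure hle)
  have hhple : ∫ z, h z * ‖p.eval z‖ ^ 2 ∂m ≤ ∫ z, ‖p.eval z‖ ^ 2 ∂ν := by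
    have h1 := integral_withDensity_eq_integral_toReal_smul (Measure.measurable_rnDeriv ν m) htop
      (fun z => ‖p.eval z‖ ^ 2)
    simp only [smul_eq_mul] at h1
    rw [← h1]
    exact integral_mono_measure hle (Filter.Eventually.of_forall fun z => by positivity) hintν
  have hKhp : Integrable (fun z => discKernel a z * (h z * ‖p.eval z‖ ^ 2)) m :=
    hhp.bdd_mul hKm hKbound
  have hupper : ∫ z, discKernel a z * (h z * ‖p.eval z‖ ^ 2) ∂m ≤
      M * ∫ z, ‖p.eval z‖ ^ 2 ∂ν := by
    refine le_trans ?_ (mul_le_mul_of_nonneg_left hhple hM0)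
    rw [← integral_const_mul]
    refine integral_mono_ae hKhp (hhp.const_mul M) ?_
    filter_upwards [hsph] with z hz
    exact mul_le_mul_of_nonneg_right (discKernel_le ha hz) (by positivity)
  set A := ‖p.eval a‖ with hA
  have hA0 : 0 < A := norm_pos_iff.2 hp
  -- Jensen is carried out through `log x ≤ x - 1` at `x = h |p|² / l`, integrated against the
  -- kernel. This `l` has `log l = 2 log A + H`, so by subharmonicity the logarithms leave `1 ≤ l⁻¹
  -- ∫ P_a h |p|²`.
  set l : ℝ := A ^ 2 * Real.exp H with hl
  have hl0 : 0 < l := by positivity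
  have hpt : ∀ᵐ z ∂m, discKernel a z * (1 - Real.log l) +
      (2 * (discKernel a z * Real.log ‖p.eval z‖) + discKernel a z * Real.log (h z)) ≤
      l⁻¹ * (discKernel a z * (h z * ‖p.eval z‖ ^ 2)) := by
    filter_upwards [hsph, hpos, htop, ae_circleLebesgue_eval_ne_zero 0 one_ne_zero hp0]
      with z hz hz0 hzt hpz
    have hhz : 0 < h z := ENNReal.toReal_pos hz0.ne' hzt.ne
    have hpz' : 0 < ‖p.eval z‖ := norm_pos_iff.2 hpz
    have h1 : Real.log (l⁻¹ * (h z * ‖p.eval z‖ ^ 2)) =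
        -Real.log l + (Real.log (h z) + 2 * Real.log ‖p.eval z‖) := by
      rw [Real.log_mul (inv_ne_zero hl0.ne') (by positivity), Real.log_inv,
        Real.log_mul hhz.ne' (by positivity), Real.log_pow]
      norm_num
    have h2 := Real.log_le_sub_one_of_pos
      (show 0 < l⁻¹ * (h z * ‖p.eval z‖ ^ 2) by positivity)
    have h3 := mul_le_mul_of_nonneg_left (h1 ▸ h2) (discKernel_nonneg ha hz)
    linarith
  have hKlogp := integrable_discKernel_mul_log_norm_eval ha p
  have hint := integral_mono_ae
    ((hK.mul_const (1 - Real.log l)).add ((hKlogp.const_mul 2).add hKlog))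
    (hKhp.const_mul l⁻¹) hpt
  have hlhs : ∫ z, (discKernel a z * (1 - Real.log l) +
      (2 * (discKernel a z * Real.log ‖p.eval z‖) + discKernel a z * Real.log (h z))) ∂m =
      (1 - Real.log l) + (2 * ∫ z, discKernel a z * Real.log ‖p.eval z‖ ∂m + H) := by
    rw [integral_add (g := fun z => 2 * (discKernel a z * Real.log ‖p.eval z‖) +
      discKernel a z * Real.log (h z)) (hK.mul_const _) ((hKlogp.const_mul 2).add hKlog),
      integral_add (hKlogp.const_mul 2) hKlog, integral_mul_const, integral_const_mul, hK1,
      one_mul]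
  have hlogl : Real.log l = 2 * Real.log A + H := by
    rw [hl, Real.log_mul (by positivity) (Real.exp_pos H).ne', Real.log_exp, Real.log_pow]
    norm_num
  have hsub := log_norm_eval_le_integral ha p hp
  have hone : 1 ≤ l⁻¹ * ∫ z, discKernel a z * (h z * ‖p.eval z‖ ^ 2) ∂m := by
    rw [← integral_const_mul]
    refine le_trans ?_ hint
    change _ ≤ ∫ z, (discKernel a z * (1 - Real.log l) +
      (2 * (discKernel a z * Real.log ‖p.eval z‖) + discKernel a z * Real.log (h z))) ∂m
    rw [hlhs]
    linarith
  have hfin : l ≤ M * ∫ z, ‖p.eval z‖ ^ 2 ∂ν := by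
    refine le_trans ?_ hupper
    have := mul_le_mul_of_nonneg_left hone hl0.le
    rwa [mul_one, mul_inv_cancel_left₀ hl0.ne'] at this
  calc A ^ 2 = Real.exp (-H) * l := by
        rw [hl, mul_left_comm, ← Real.exp_add, neg_add_cancel, Real.exp_zero, mul_one]
    _ ≤ Real.exp (-H) * (M * ∫ z, ‖p.eval z‖ ^ 2 ∂ν) :=
        mul_le_mul_of_nonneg_left hfin (Real.exp_pos _).le
    _ = M * Real.exp (-H) * ∫ z, ‖p.eval z‖ ^ 2 ∂ν := by ring

/-! ### A Poincaré inequality on circles -/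

/-- By Parseval: the coefficients of `q'` are `(i + 1) q_{i+1}`, at least as large in modulus as
`q_{i+1}`. -/
theorem circleAverage_norm_eval_sq_le (q : ℂ[X]) :
    Real.circleAverage (fun z => ‖q.eval z‖ ^ 2) 0 1 ≤
      ‖q.eval 0‖ ^ 2 + Real.circleAverage (fun z => ‖q.derivative.eval z‖ ^ 2) 0 1 := by
  have hsum : ∀ (p : ℂ[X]) (N : ℕ), p.natDegree < N →
      Real.circleAverage (fun z => ‖p.eval z‖ ^ 2) 0 1 =
        ∑ i ∈ Finset.range N, ‖p.coeff i‖ ^ 2 := by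
    intro p N hN
    rw [← sum_sq_norm_coeff_eq_circleAverage]
    refine Finset.sum_subset (fun i hi => ?_) (fun i _ hi => ?_)
    · exact Finset.mem_range.2 ((le_natDegree_of_mem_supp i hi).trans_lt hN)
    · rw [notMem_support_iff.1 hi, norm_zero, zero_pow two_ne_zero]
  -- The cutoff `natDegree + 2` leaves `natDegree + 1` for the derivative, which is valid even for
  -- constant `q`.
  rw [hsum q (q.natDegree + 2) (by omega), Finset.sum_range_succ', add_comm,
    hsum q.derivative (q.natDegree + 1) ((natDegree_derivative_le q).trans_lt (by omega)),
    coeff_zero_eq_eval_zero]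
  gcongr with i _
  rw [coeff_derivative, norm_mul]
  refine le_mul_of_one_le_right (norm_nonneg _) ?_
  have h : ‖((i : ℂ) + 1)‖ = (i : ℝ) + 1 := by
    exact_mod_cast Complex.norm_natCast (i + 1)
  rw [h]
  exact le_add_of_nonneg_left i.cast_nonneg

theorem integral_circleLebesgue_norm_eval_sq_le (a : ℂ) (r : ℝ) (p : ℂ[X]) :
    ∫ z, ‖p.eval z‖ ^ 2 ∂(circleLebesgue a r) ≤
      ‖p.eval a‖ ^ 2 + r ^ 2 * ∫ z, ‖p.derivative.eval z‖ ^ 2 ∂(circleLebesgue a r) := by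
  have hm : ∀ q : ℂ[X], Measurable fun z => ‖q.eval z‖ ^ 2 :=
    fun q => (q.continuous.norm.pow 2).measurable
  rw [integral_circleLebesgue (hm p), integral_circleLebesgue (hm p.derivative),
    Real.circleAverage_eq_circleAverage_zero_one,
    Real.circleAverage_eq_circleAverage_zero_one (c := a), ← smul_eq_mul (r ^ 2),
    ← Real.circleAverage_fun_smul]
  -- Rescale to the unit circle; the chain rule produces the factor `r²`.
  have h := circleAverage_norm_eval_sq_le (p.comp (C (r : ℂ) * X + C a))
  simpa [derivative_comp, mul_pow] using h

/-! ### Sobolev forms -/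

/-- `⟨p, q⟩ = ∫ p q̄ dν + ∑ ∫ p' q̄' dμ_k`. -/
noncomputable def sobolevForm (ν : Measure ℂ) {n : ℕ} (μ : Fin n → Measure ℂ) (p q : ℂ[X]) : ℂ :=
  (∫ z, p.eval z * conj (q.eval z) ∂ν) +
    ∑ k, ∫ z, p.derivative.eval z * conj (q.derivative.eval z) ∂(μ k)

/-- `‖p‖² = ∫ |p|² dν + ∑ ∫ |p'|² dμ_k`. -/
noncomputable def sobolevEnergy (ν : Measure ℂ) {n : ℕ} (μ : Fin n → Measure ℂ) (p : ℂ[X]) : ℝ :=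
  (∫ z, ‖p.eval z‖ ^ 2 ∂ν) + ∑ k, ∫ z, ‖p.derivative.eval z‖ ^ 2 ∂(μ k)

section Sobolev

variable {ν : Measure ℂ} {n : ℕ} {μ : Fin n → Measure ℂ}

theorem sobolevForm_self (p : ℂ[X]) : sobolevForm ν μ p p = (sobolevEnergy ν μ p : ℂ) := by
  have h : ∀ w : ℂ, w * conj w = ((‖w‖ ^ 2 : ℝ) : ℂ) := fun w => by
    rw [Complex.mul_conj, Complex.normSq_eq_norm_sq]
  simp only [sobolevForm, sobolevEnergy, h, integral_complex_ofReal, Complex.ofReal_add,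
    Complex.ofReal_sum]

theorem sobolevEnergy_nonneg (p : ℂ[X]) : 0 ≤ sobolevEnergy ν μ p := by
  unfold sobolevEnergy
  positivity

theorem integral_norm_eval_sq_le_sobolevEnergy (p : ℂ[X]) :
    ∫ z, ‖p.eval z‖ ^ 2 ∂ν ≤ sobolevEnergy ν μ p :=
  le_add_of_nonneg_right (Finset.sum_nonneg fun _ _ => integral_nonneg fun _ => by positivity)

theorem conj_sobolevForm (p q : ℂ[X]) : conj (sobolevForm ν μ p q) = sobolevForm ν μ q p := by
  simp only [sobolevForm, map_add, map_sum, ← integral_conj, map_mul, Complex.conj_conj, mul_comm]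

theorem integrable_eval_mul_conj_eval {ρ : Measure ℂ} [IsFiniteMeasure ρ]
    (hρ : ∀ᵐ z ∂ρ, z ∈ Metric.closedBall (0 : ℂ) 1) (p q : ℂ[X]) :
    Integrable (fun z => p.eval z * conj (q.eval z)) ρ :=
  integrable_of_ae_mem_closedBall hρ
    (p.continuous.mul (Complex.continuous_conj.comp q.continuous))

theorem integrable_norm_eval_sq {ρ : Measure ℂ} [IsFiniteMeasure ρ]
    (hρ : ∀ᵐ z ∂ρ, z ∈ Metric.closedBall (0 : ℂ) 1) (p : ℂ[X]) :
    Integrable (fun z => ‖p.eval z‖ ^ 2) ρ :=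
  integrable_of_ae_mem_closedBall hρ (p.continuous.norm.pow 2)

theorem sobolevForm_C_mul_left (c : ℂ) (p q : ℂ[X]) :
    sobolevForm ν μ (C c * p) q = c * sobolevForm ν μ p q := by
  simp only [sobolevForm, eval_mul, eval_C, derivative_C_mul, mul_assoc, integral_const_mul,
    mul_add, Finset.mul_sum]

/-- Bounded evaluation forces `p` to vanish throughout the disc. This definiteness allows division
by `‖q‖²` in the bound on zeros. -/
theorem SzegoCondition.eq_zero_of_sobolevEnergy_eq_zero [IsFiniteMeasure ν]
    (hν : ∀ᵐ z ∂ν, z ∈ Metric.closedBall (0 : ℂ) 1) (hS : SzegoCondition ν) {p : ℂ[X]}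
    (hp : sobolevEnergy ν μ p = 0) : p = 0 := by
  refine eq_zero_of_infinite_isRoot p
    ((infinite_of_mem_nhds (0 : ℂ) (Metric.ball_mem_nhds 0 one_pos)).mono fun a ha => ?_)
  obtain ⟨C, hC0, hC⟩ := hS.exists_norm_eval_sq_le hν ha
  have h1 : ∫ z, ‖p.eval z‖ ^ 2 ∂ν ≤ 0 := hp ▸ integral_norm_eval_sq_le_sobolevEnergy p
  have h2 := (hC p).trans (mul_nonpos_of_nonneg_of_nonpos hC0 h1)
  have h3 : ‖p.eval a‖ = 0 := by nlinarith [norm_nonneg (p.eval a)]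
  exact norm_eq_zero.1 h3

variable [IsFiniteMeasure ν] [∀ k, IsFiniteMeasure (μ k)]

theorem sobolevForm_add_left (hν : ∀ᵐ z ∂ν, z ∈ Metric.closedBall (0 : ℂ) 1)
    (hμ : ∀ k, ∀ᵐ z ∂(μ k), z ∈ Metric.closedBall (0 : ℂ) 1) (p₁ p₂ q : ℂ[X]) :
    sobolevForm ν μ (p₁ + p₂) q = sobolevForm ν μ p₁ q + sobolevForm ν μ p₂ q := by
  simp only [sobolevForm, eval_add, derivative_add, add_mul]
  rw [integral_add (integrable_eval_mul_conj_eval hν _ _) (integrable_eval_mul_conj_eval hν _ _),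
    Finset.sum_congr rfl fun k _ => integral_add (integrable_eval_mul_conj_eval (hμ k) _ _)
      (integrable_eval_mul_conj_eval (hμ k) _ _), Finset.sum_add_distrib]
  ring

/-- Pythagoras for orthogonal polynomials. -/
theorem sobolevEnergy_add_C_mul (hν : ∀ᵐ z ∂ν, z ∈ Metric.closedBall (0 : ℂ) 1)
    (hμ : ∀ k, ∀ᵐ z ∂(μ k), z ∈ Metric.closedBall (0 : ℂ) 1) {p q : ℂ[X]}
    (hpq : sobolevForm ν μ p q = 0) (c : ℂ) :
    sobolevEnergy ν μ (p + C c * q) = sobolevEnergy ν μ p + ‖c‖ ^ 2 * sobolevEnergy ν μ q := by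
  have hqp : sobolevForm ν μ q p = 0 := by rw [← conj_sobolevForm, hpq, map_zero]
  have hright : ∀ f : ℂ[X], sobolevForm ν μ f (p + C c * q) =
      sobolevForm ν μ f p + conj c * sobolevForm ν μ f q := by
    intro f
    rw [← conj_sobolevForm, sobolevForm_add_left hν hμ, sobolevForm_C_mul_left, map_add, map_mul,
      conj_sobolevForm, conj_sobolevForm]
  have h : (sobolevEnergy ν μ (p + C c * q) : ℂ) =
      ((sobolevEnergy ν μ p + ‖c‖ ^ 2 * sobolevEnergy ν μ q : ℝ) : ℂ) := by
    rw [← sobolevForm_self, sobolevForm_add_left hν hμ, sobolevForm_C_mul_left, hright, hright,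
      hpq, hqp, sobolevForm_self, sobolevForm_self, mul_zero, add_zero, zero_add, ← mul_assoc,
      Complex.mul_conj, Complex.normSq_eq_norm_sq]
    push_cast
    rfl
  exact_mod_cast h

theorem exists_sobolevEnergy_X_mul_le (hν : ∀ᵐ z ∂ν, z ∈ Metric.closedBall (0 : ℂ) 1)
    (hμ : ∀ k, ∀ᵐ z ∂(μ k), z ∈ Metric.closedBall (0 : ℂ) 1)
    (hC : ∀ k, ∃ C : ℝ, ∀ p : ℂ[X], ∫ z, ‖p.eval z‖ ^ 2 ∂(μ k) ≤ C * sobolevEnergy ν μ p) :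
    ∃ C : ℝ, 0 ≤ C ∧ ∀ p : ℂ[X], sobolevEnergy ν μ (X * p) ≤ C * sobolevEnergy ν μ p := by
  choose D hD using hC
  have hE : ∀ p, ∑ k, ∫ z, ‖(X * p).derivative.eval z‖ ^ 2 ∂(μ k) ≤
      2 * (∑ k, D k) * sobolevEnergy ν μ p + 2 * sobolevEnergy ν μ p := by
    intro p
    have hk : ∀ k, ∫ z, ‖(X * p).derivative.eval z‖ ^ 2 ∂(μ k) ≤
        2 * (D k * sobolevEnergy ν μ p) + 2 * ∫ z, ‖p.derivative.eval z‖ ^ 2 ∂(μ k) := by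
      intro k
      have h1 := integrable_norm_eval_sq (hμ k) p
      have h2 := integrable_norm_eval_sq (hμ k) p.derivative
      refine le_trans ?_ (add_le_add_left (mul_le_mul_of_nonneg_left (hD k p) zero_le_two) _)
      rw [← integral_const_mul, ← integral_const_mul,
        ← integral_add (h1.const_mul 2) (h2.const_mul 2)]
      refine integral_mono_ae (integrable_norm_eval_sq (hμ k) _)
        ((h1.const_mul 2).add (h2.const_mul 2)) ?_
      filter_upwards [hμ k] with z hz
      have hz : ‖z‖ ≤ 1 := by simpa using hz
      have hle : ‖(X * p).derivative.eval z‖ ≤ ‖p.eval z‖ + ‖p.derivative.eval z‖ := by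
        rw [derivative_mul, derivative_X, one_mul, eval_add, eval_mul, eval_X]
        refine (norm_add_le _ _).trans (add_le_add_right ?_ _)
        rw [norm_mul]
        exact mul_le_of_le_one_left (norm_nonneg _) hz
      have h0 := norm_nonneg ((X * p).derivative.eval z)
      nlinarith [sq_nonneg (‖p.eval z‖ - ‖p.derivative.eval z‖)]
    have hder : ∑ k, ∫ z, ‖p.derivative.eval z‖ ^ 2 ∂(μ k) ≤ sobolevEnergy ν μ p :=
      le_add_of_nonneg_left (integral_nonneg fun _ => by positivity)
    calc _ ≤ ∑ k, (2 * (D k * sobolevEnergy ν μ p) +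
          2 * ∫ z, ‖p.derivative.eval z‖ ^ 2 ∂(μ k)) := Finset.sum_le_sum fun k _ => hk k
      _ = 2 * (∑ k, D k) * sobolevEnergy ν μ p +
          2 * ∑ k, ∫ z, ‖p.derivative.eval z‖ ^ 2 ∂(μ k) := by
        rw [Finset.sum_add_distrib, ← Finset.mul_sum, ← Finset.mul_sum, ← Finset.sum_mul, mul_assoc]
      _ ≤ _ := by linarith
  have hX : ∀ p : ℂ[X], ∫ z, ‖(X * p).eval z‖ ^ 2 ∂ν ≤ sobolevEnergy ν μ p := by
    intro p
    refine le_trans (integral_mono_ae (integrable_norm_eval_sq hν _)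
      (integrable_norm_eval_sq hν p) ?_) (integral_norm_eval_sq_le_sobolevEnergy p)
    filter_upwards [hν] with z hz
    have hz : ‖z‖ ≤ 1 := by simpa using hz
    rw [eval_mul, eval_X, norm_mul]
    exact pow_le_pow_left₀ (by positivity) (mul_le_of_le_one_left (norm_nonneg _) hz) 2
  -- The 3 is 1 from the `ν` term plus 2 from the `zp'` terms; the maximum is needed because no sign
  -- is known for `D k`.
  refine ⟨max 0 (3 + 2 * ∑ k, D k), le_max_left _ _, fun p => ?_⟩
  refine le_trans ?_ (mul_le_mul_of_nonneg_right (le_max_right _ _) (sobolevEnergy_nonneg p))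
  have h1 := hX p
  have h2 := hE p
  rw [sobolevEnergy]
  linarith

theorem SzegoCondition.multiplicationBounded_and_isBounded_orthogonalZeros
    (hν : ∀ᵐ z ∂ν, z ∈ Metric.closedBall (0 : ℂ) 1) (hS : SzegoCondition ν)
    (hμ : ∀ k, ∀ᵐ z ∂(μ k), z ∈ Metric.closedBall (0 : ℂ) 1)
    (hC : ∀ k, ∃ C : ℝ, ∀ p : ℂ[X], ∫ z, ‖p.eval z‖ ^ 2 ∂(μ k) ≤ C * sobolevEnergy ν μ p) :
    MultiplicationBounded (fun p => √(sobolevEnergy ν μ p)) ∧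
      Bornology.IsBounded (orthogonalZeros (sobolevForm ν μ)) := by
  obtain ⟨D, hD0, hD⟩ := exists_sobolevEnergy_X_mul_le hν hμ hC
  refine ⟨⟨√D, fun p => ?_⟩, ?_⟩
  · rw [← Real.sqrt_mul hD0]
    exact Real.sqrt_le_sqrt (hD p)
  · refine Metric.isBounded_closedBall (x := (0 : ℂ)) (r := √D) |>.subset ?_
    rintro w ⟨P, ⟨hP0, hP⟩, hw⟩
    obtain ⟨q, rfl⟩ := dvd_iff_isRoot.2 hw
    have hq0 : q ≠ 0 := right_ne_zero_of_mul hP0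
    have hdeg : q.degree < ((X - C w) * q).degree := by
      rw [degree_mul, degree_X_sub_C, degree_eq_natDegree hq0]
      exact_mod_cast Nat.lt_one_add_iff.2 le_rfl
    have hpy := sobolevEnergy_add_C_mul hν hμ (hP q hdeg) w
    rw [show (X - C w) * q + C w * q = X * q by ring] at hpy
    have hqpos : 0 < sobolevEnergy ν μ q := (sobolevEnergy_nonneg q).lt_of_ne fun h =>
      hq0 (hS.eq_zero_of_sobolevEnergy_eq_zero hν h.symm)
    have hle : ‖w‖ ^ 2 * sobolevEnergy ν μ q ≤ D * sobolevEnergy ν μ q := by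
      have h1 := hD q
      have h2 := sobolevEnergy_nonneg (ν := ν) (μ := μ) ((X - C w) * q)
      linarith
    rw [mem_closedBall_zero_iff]
    exact Real.le_sqrt_of_sq_le (le_of_mul_le_mul_right hle hqpos)

end Sobolev

theorem proposition6 (ν : Measure ℂ) [IsFiniteMeasure ν]
    (hsupp : ν (Metric.sphere (0 : ℂ) 1)ᶜ = 0) (hS : SzegoCondition ν) :
    (∀ (n : ℕ) (a : Fin n → ℂ), (∀ k, a k ∈ Metric.ball (0 : ℂ) 1) →
      MultiplicationBounded (discreteSobolevNorm ν a) ∧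
      Bornology.IsBounded (orthogonalZeros (discreteSobolevInner ν a))) ∧
    (∀ (n : ℕ) (a : Fin n → ℂ) (r : Fin n → ℝ), (∀ k, 0 < r k) →
      (∀ k, Metric.ball (a k) (r k) ⊆ Metric.ball (0 : ℂ) 1) →
      MultiplicationBounded (circleSobolevNorm ν a r) ∧
      Bornology.IsBounded (orthogonalZeros (circleSobolevInner ν a r))) := by
  have hν : ∀ᵐ z ∂ν, z ∈ Metric.closedBall (0 : ℂ) 1 := by
    have h : ∀ᵐ z ∂ν, z ∈ Metric.sphere (0 : ℂ) 1 := hsupp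
    exact h.mono fun z hz => Metric.sphere_subset_closedBall hz
  refine ⟨fun n a ha => ?_, fun n a r hr hsub => ?_⟩
  · have hform : discreteSobolevInner ν a = sobolevForm ν fun k => Measure.dirac (a k) := by
      ext p q
      simp [discreteSobolevInner, sobolevForm]
    have hnorm : discreteSobolevNorm ν a =
        fun p => √(sobolevEnergy ν (fun k => Measure.dirac (a k)) p) := by
      ext p
      simp [discreteSobolevNorm, sobolevEnergy]
    rw [hform, hnorm]
    refine hS.multiplicationBounded_and_isBounded_orthogonalZeros hν (fun k => ?_) fun k => ?_
    · rw [ae_dirac_eq]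
      exact Metric.ball_subset_closedBall (ha k)
    · obtain ⟨C, hC0, hC⟩ := hS.exists_norm_eval_sq_le hν (ha k)
      refine ⟨C, fun p => ?_⟩
      rw [integral_dirac]
      exact (hC p).trans
        (mul_le_mul_of_nonneg_left (integral_norm_eval_sq_le_sobolevEnergy p) hC0)
  · refine hS.multiplicationBounded_and_isBounded_orthogonalZeros
      (μ := fun k => circleLebesgue (a k) (r k)) hν (fun k => ?_) fun k => ?_
    · have hcl : Metric.closedBall (a k) (r k) ⊆ Metric.closedBall (0 : ℂ) 1 := by
        rw [← closure_ball (a k) (hr k).ne', ← closure_ball (0 : ℂ) one_ne_zero]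
        exact closure_mono (hsub k)
      exact (ae_circleLebesgue_mem_sphere (a k) (hr k).le).mono fun z hz =>
        hcl (Metric.sphere_subset_closedBall hz)
    -- The circle may touch the unit circle, where no evaluation bound is available, so only its
    -- centre is evaluated.
    · obtain ⟨C, hC0, hC⟩ :=
        hS.exists_norm_eval_sq_le hν (hsub k (Metric.mem_ball_self (hr k)))
      refine ⟨C + r k ^ 2, fun p => ?_⟩
      set E := sobolevEnergy ν (fun k => circleLebesgue (a k) (r k)) p with hE
      have h1 : ∫ z, ‖p.derivative.eval z‖ ^ 2 ∂(circleLebesgue (a k) (r k)) ≤ E :=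
        (Finset.single_le_sum (f := fun k =>
          ∫ z, ‖p.derivative.eval z‖ ^ 2 ∂(circleLebesgue (a k) (r k)))
          (fun _ _ => integral_nonneg fun _ => by positivity) (Finset.mem_univ k)).trans
          (le_add_of_nonneg_left (integral_nonneg fun _ => by positivity))
      have h2 := (hC p).trans (mul_le_mul_of_nonneg_left
        (integral_norm_eval_sq_le_sobolevEnergy (μ := fun k => circleLebesgue (a k) (r k)) p) hC0)
      calc _ ≤ _ := integral_circleLebesgue_norm_eval_sq_le (a k) (r k) p
        _ ≤ C * E + r k ^ 2 * E :=
          add_le_add h2 (mul_le_mul_of_nonneg_left h1 (sq_nonneg _))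
        _ = (C + r k ^ 2) * E := by ring
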